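/- **Conventions.** All compact groups are Hausdorff; $m_G$ denotes the Haar probability measure of a compact group $G$ (extended to its completion, so that it is defined on products $AB=\{ab: a\in A,\ b\in B\}$ of Borel sets when $G$ is second countable), and $\mathbb T$ is the circle group. A *closed symmetric interval* in $\mathbb T$ is a set $\{e^{i\theta}: -r\le\theta\le r\}$ with $r\ge 0$. A *critical pair* in a compact group $N$ is a pair $(A,B)$ of Borel sets of positive Haar measure with $m_N(AB)=m_N(A)+m_N(B)<1$. Such a pair *strictly reduces* to a pair $(I,J)$ of subsets of a compact group $M$ if $m_N(AB)=m_M(IJ)$ and there are a compact group $K$ of topological automorphisms of $M$ with $k(J)=J$ for all $k\in K$, a continuous surjective homomorphism $\pi:N\to M\rtimes K$, and $s,t\in M\rtimes K$ such that $A\subset\pi^{-1}(s(I\rtimes K))$ and $B\subset\pi^{-1}((J\rtimes K)t)$. A compact connected group $N$ is a *Kneser group* if every critical pair in $N$ strictly reduces to a pair of closed symmetric intervals in $\mathbb T$. The identity component $N$ of a compact group $G$ *splits* if there is a totally disconnected subgroup $Q<G$ such that $G$ is, as a topological group, the semidirect product $N\rtimes Q$. For $x\in G$ let $(m_G)_x^N$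 be the translate of $m_N$ by $x$, a probability measure on the coset $Nx$. A pair $(A,B)$ of Borel sets of $G$ is *critical with respect to $N$* if $m_G(A)>0$, $m_G(B)>0$, $m_G(A)+m_G(B)<1$, and there are conull Borel sets $X\subset G$ and $Z\subset X\times X$ (conull for $m_G$ and $m_G\times m_G$) such that $(m_G)_x^N(A)=m_G(A)$ and $(m_G)_y^N(B)=m_G(B)$ for all $x,y\in X$, and $(m_G)_{xy}^N(AB)=(m_G)_x^N(A)+(m_G)_y^N(B)$ for all $(x,y)\in Z$. **Proposition.** Let $G$ be a compact and second countable group whose identity component $N$ splits and is a Kneser group, and let $(A,B)$ be critical with respect to $N$. Then there exist a continuous surjective homomorphism $\xi:N\to\mathbb T$ and closed symmetric intervals $I_0,J_0\subset\mathbb T$ with $$m_G(A)=m_{\mathbb T}(I_0),\qquad m_G(B)=m_{\mathbb T}(J_0),$$ conull Borel sets $X\subset G$ and $Y\subset X\times X$, and Borel measurable maps $\alpha_0,\beta_0:X\to\mathbb T$ such that $$p^{-1}A\cap N\subset\xi^{-1}\big(I_0\,\alpha_0(p)\big)\quad\text{and}\quad Bq^{-1}\cap N\subset\xi^{-1}\big(J_0\,\beta_0(q)\big)\qquad\text{for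 all }(p,q)\in Y.$$ Furthermore, there is a continuous homomorphism $\epsilon:G/N\to\{-1,1\}$ such that, writing $\epsilon(p)$ for $\epsilon(pN)$, $$\xi(pnp^{-1})=\xi(n)^{\epsilon(p)}\qquad\text{for all }n\in N,\ p\in G,$$ and $$\big(\alpha_0(p)\beta_0(q)\big)^{\epsilon(p)}=\big(\alpha_0(p')\beta_0(q')\big)^{\epsilon(p')}$$ whenever $(p,q),(p',q')\in Y$ and $pq=p'q'$. -/

import Mathlib

open MeasureTheory Topology
open scoped Pointwise

/-! ### The circle group with its Borel structure -/

noncomputable instance Circle.borelMeasurableSpace : MeasurableSpace Circle := borel Circle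

instance Circle.borelSpaceInstance : BorelSpace Circle := ⟨rfl⟩

/-- A closed interval of the circle group which is symmetric around the identity element. -/
def IsClosedSymmetricInterval (I : Set Circle) : Prop :=
  ∃ r : ℝ, 0 ≤ r ∧ I = Circle.exp '' Set.Icc (-r) r

/-! ### Haar probability measure and critical pairs -/

/-- The Haar probability measure of a compact group. -/
noncomputable def haarProb (G : Type*) [Group G] [TopologicalSpace G] [IsTopologicalGroup G]
    [CompactSpace G] [MeasurableSpace G] [BorelSpace G] : Measure G :=
  Measure.haarMeasure (⊤ : TopologicalSpace.PositiveCompacts G)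

section Critical

variable {G : Type*} [Group G] [TopologicalSpace G] [IsTopologicalGroup G]
  [CompactSpace G] [MeasurableSpace G] [BorelSpace G]

/-- A critical pair: Borel sets of positive measure with `m(AB) = m(A) + m(B) < 1`. The product
set `A * B` need not be Borel; the value of a measure on it is its outer measure, which for sets
measurable with respect to the completion is the value of the completed measure. -/
structure IsCriticalPair (A B : Set G) : Prop where
  measurableSet_left : MeasurableSet A
  measurableSet_right : MeasurableSet B
  pos_left : 0 < haarProb G A
  pos_right : 0 < haarProb G B
  measure_mul : haarProb G (A * B) = haarProb G A + haarProb G B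
  sum_lt_one : haarProb G A + haarProb G B < 1

/-- The `N`-invariant probability measure on the coset `N x`: the translate by `x` of the Haar
probability measure of `N`. -/
noncomputable def cosetMeasure (N : Subgroup G) [CompactSpace N] (x : G) : Measure G :=
  (haarProb N).map (fun n : N => (n : G) * x)

/-- A critical pair with respect to a closed normal subgroup `N`. -/
structure IsCriticalPairRel (N : Subgroup G) [N.Normal] [CompactSpace N] (A B : Set G) :
    Prop where
  measurableSet_left : MeasurableSet A
  measurableSet_right : MeasurableSet B
  pos_left : 0 < haarProb G A
  pos_right : 0 < haarProb G B
  sum_lt_one : haarProb G A + haarProb G B < 1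
  exists_conull : ∃ (X : Set G) (Z : Set (G × G)),
    MeasurableSet X ∧ haarProb G Xᶜ = 0 ∧
    MeasurableSet Z ∧ Z ⊆ X ×ˢ X ∧ ((haarProb G).prod (haarProb G)) Zᶜ = 0 ∧
    (∀ x ∈ X, cosetMeasure N x A = haarProb G A ∧ cosetMeasure N x B = haarProb G B) ∧
    ∀ x y : G, (x, y) ∈ Z →
      cosetMeasure N (x * y) (A * B) = cosetMeasure N x A + cosetMeasure N y B

end Critical

/-! ### Reduction of pairs and Kneser groups -/

/-- A compact group of topological automorphisms of a (compact) group `M`; groups of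
automorphisms carry the compact-open topology. -/
structure CompactAutSubgroup (M : Type*) [Group M] [TopologicalSpace M] where
  /-- the underlying group of automorphisms -/
  toSubgroup : Subgroup (MulAut M)
  continuous_apply : ∀ k : toSubgroup, Continuous (k : MulAut M)
  isCompact_range :
    IsCompact (Set.range fun k : toSubgroup => (⟨(k : MulAut M), continuous_apply k⟩ : C(M, M)))

namespace CompactAutSubgroup

variable {M : Type*} [Group M] [TopologicalSpace M]

/-- An element of a compact group of automorphisms as a continuous map. -/
def toContinuousMap (K : CompactAutSubgroup M) (k : K.toSubgroup) : C(M, M) :=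
  ⟨(k : MulAut M), K.continuous_apply k⟩

/-- The semidirect product `M ⋊ K`. -/
abbrev Semi (K : CompactAutSubgroup M) : Type _ := M ⋊[K.toSubgroup.subtype] K.toSubgroup

/-- The product topology on `M ⋊ K`, where `K` has the compact-open topology. -/
instance (K : CompactAutSubgroup M) : TopologicalSpace K.Semi :=
  TopologicalSpace.induced (fun x => (x.left, K.toContinuousMap x.right)) inferInstance

/-- The subset `I ⋊ K` of `M ⋊ K`. -/
def semiSet (K : CompactAutSubgroup M) (I : Set M) : Set K.Semi := {x | x.left ∈ I}

end CompactAutSubgroup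

/-- The pair `(A, B)` in `G` strictly reduces to the pair `(I, J)` in `M`: the product sets `AB`
and `IJ` have the same measure, and there are a compact group `K` of automorphisms of `M` fixing
`J` and a continuous surjective homomorphism `π : G → M ⋊ K` such that `A ⊆ π⁻¹(s (I ⋊ K))` and
`B ⊆ π⁻¹((J ⋊ K) t)` for some `s, t` in `M ⋊ K`. -/
def StrictlyReduces {G M : Type*}
    [Group G] [TopologicalSpace G] [IsTopologicalGroup G] [CompactSpace G]
    [MeasurableSpace G] [BorelSpace G]
    [Group M] [TopologicalSpace M] [IsTopologicalGroup M] [CompactSpace M]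
    [MeasurableSpace M] [BorelSpace M]
    (A B : Set G) (I J : Set M) : Prop :=
  haarProb G (A * B) = haarProb M (I * J) ∧
  ∃ K : CompactAutSubgroup M, (∀ k : K.toSubgroup, (k : MulAut M) '' J = J) ∧
    ∃ π : G →* K.Semi, Continuous π ∧ Function.Surjective π ∧
      ∃ s t : K.Semi,
        A ⊆ π ⁻¹' ((fun x => s * x) '' K.semiSet I) ∧
        B ⊆ π ⁻¹' ((fun x => x * t) '' K.semiSet J)

/-- A Kneser group: a compact connected group in which every critical pair strictly reduces to a
pair of closed symmetric intervals in the circle group. -/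
def IsKneserGroup (N : Type*) [Group N] [TopologicalSpace N] [IsTopologicalGroup N]
    [CompactSpace N] [MeasurableSpace N] [BorelSpace N] : Prop :=
  ConnectedSpace N ∧
  ∀ A B : Set N, IsCriticalPair A B →
    ∃ I J : Set Circle, IsClosedSymmetricInterval I ∧ IsClosedSymmetricInterval J ∧
      StrictlyReduces A B I J

/-! ### The identity component -/

section IdentityComponent

variable (G : Type*) [Group G] [TopologicalSpace G] [IsTopologicalGroup G]

/-- The identity component of a topological group. -/
abbrev identityComponent : Subgroup G := Subgroup.connectedComponentOfOne G

instance identityComponent_normal : (identityComponent G).Normal where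
  conj_mem n hn g := by
    have hc : Continuous fun x : G => g * x * g⁻¹ := by fun_prop
    have h := hc.image_connectedComponent_subset 1 (Set.mem_image_of_mem _ hn)
    have e : g * 1 * g⁻¹ = 1 := by simp
    rw [e] at h
    exact h

instance identityComponent_compactSpace [CompactSpace G] :
    CompactSpace (identityComponent G) :=
  isCompact_iff_compactSpace.mp
    (isClosed_connectedComponent (x := (1 : G))).isCompact

/-- The subgroup `N` splits: `G` is, as a topological group, the semidirect product of `N` and a
totally disconnected subgroup `Q`. -/
def Splits {G : Type*} [Group G] [TopologicalSpace G] (N : Subgroup G) [N.Normal] : Prop :=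
  ∃ Q : Subgroup G, TotallyDisconnectedSpace Q ∧
    IsHomeomorph (fun x : N × Q => (x.1 : G) * (x.2 : G))

end IdentityComponent

section Slices

variable {G : Type*} [Group G]

/-- The set `p⁻¹ A ∩ N`, as a subset of `N`. -/
def leftSlice (N : Subgroup G) (A : Set G) (p : G) : Set N := {n | (n : G) ∈ p⁻¹ • A}

/-- The set `B q⁻¹ ∩ N`, as a subset of `N`. -/
def rightSlice (N : Subgroup G) (B : Set G) (q : G) : Set N :=
  {n | (n : G) ∈ (fun b => b * q⁻¹) '' B}

/-- The automorphism `n ↦ p n p⁻¹` of the normal subgroup `N` induced by `p`. -/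
def conjAut (N : Subgroup G) [N.Normal] (p : G) : MulAut N := MulAut.conjNormal p

end Slices

/-! Write `N` for the identity component. For generic `(p, q)`, the product of the slices `p⁻¹A ∩ N`
and `Bq⁻¹ ∩ N` is, up to conjugation by `p`, contained in the slice of `AB` over the coset of `pq`,
whose measure is `m(A) + m(B)`. Kemperman's inequality in the connected group `N` gives the reverse
bound, so the slices form a critical pair and the Kneser property puts them inside preimages of arcs
under one character. Comparing measures forces the half-lengths to be `π m(A)` and `π m(B)`, so each
slice fills its arc preimage up to a null set.

The main tool is rigidity (`eq_or_eq_inv_of_preimage_symmArc_ae_eq`): an arc preimage of measure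
strictly between 0 and 1 determines its character up to inversion, and then its centre, because the
integral of the character over it is a nonzero multiple of the centre. Fix a generic `p₀` and take
`ξ` from there. The pairs `(p₀, q)` and `(p, q)` share the slice of `B` at `q`, and all pairs `(p₀,
q)` share the slice of `A` at `p₀`; hence `ξ` serves for almost all `(p, q)`, inversion being
absorbed by the symmetry of the arcs. The centres are phases of integrals of `ξ` over slices, hence
measurable.

If `pq = p'q'`, both product arcs, transported by conjugation, agree almost everywhere with the same
slice of `AB`. Taking `p' = pg` with arbitrary `g`, rigidity shows that conjugation by `g` sends `ξ`
to `ξ` or its inverse, which defines the sign. Comparing centres then gives the identity between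
`α₀` and `β₀`. -/

/-! ### Invariance of the Haar probability measure -/

section HaarProb

variable {G : Type*} [Group G] [TopologicalSpace G] [IsTopologicalGroup G]
  [CompactSpace G] [MeasurableSpace G] [BorelSpace G]

instance haarProb_isHaarMeasure : (haarProb G).IsHaarMeasure := by
  unfold haarProb; infer_instance

instance haarProb_regular : (haarProb G).Regular := by
  unfold haarProb; infer_instance

instance haarProb_isProbabilityMeasure : IsProbabilityMeasure (haarProb G) :=
  ⟨by unfold haarProb; exact Measure.haarMeasure_self⟩

instance haarProb_isMulRightInvariant : (haarProb G).IsMulRightInvariant where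
  map_mul_right_eq_self g := by
    have : IsProbabilityMeasure ((haarProb G).map (· * g)) :=
      Measure.isProbabilityMeasure_map (by fun_prop)
    exact Measure.isHaarMeasure_eq_of_isProbabilityMeasure _ _

instance haarProb_isInvInvariant : (haarProb G).IsInvInvariant where
  inv_eq_self := by
    have : IsProbabilityMeasure (haarProb G).inv :=
      Measure.isProbabilityMeasure_map (by fun_prop)
    have : (haarProb G).inv.IsHaarMeasure :=
      Measure.isHaarMeasure_of_isCompact_nonempty_interior _ Set.univ isCompact_univ (by simp)
        (by simp) (by simp)
    exact Measure.isHaarMeasure_eq_of_isProbabilityMeasure _ _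

/-- A continuous surjective homomorphism of compact groups preserves Haar probability measures. -/
theorem haarProb_measurePreserving {H : Type*} [Group H] [TopologicalSpace H]
    [IsTopologicalGroup H] [CompactSpace H] [MeasurableSpace H] [BorelSpace H]
    (f : G →* H) (hf : Continuous f) (hs : Function.Surjective f) :
    MeasurePreserving f (haarProb G) (haarProb H) :=
  f.measurePreserving hf hs (by simp)

end HaarProb

/-! ### Kemperman's inequality in compact connected groups -/

section Kemperman

set_option linter.unusedSectionVars false

variable {G : Type*} [Group G] [TopologicalSpace G] [IsTopologicalGroup G]
  [CompactSpace G] [T2Space G] [MeasurableSpace G] [BorelSpace G]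

/-- Pigeonhole: for each `x` the sets `A` and `x B⁻¹` have total measure above 1, so they meet. -/
theorem mul_eq_univ_of_one_lt_add {A B : Set G} (hB : MeasurableSet B)
    (h : 1 < (haarProb G).real A + (haarProb G).real B) : A * B = Set.univ := by
  refine Set.eq_univ_of_forall fun x => ?_
  have hx : (haarProb G).real ((fun y => y⁻¹ * x) ⁻¹' B) = (haarProb G).real B := by
    have h1 : MeasurePreserving (fun y : G => y⁻¹ * x) (haarProb G) (haarProb G) :=
      (measurePreserving_mul_right _ x).comp (Measure.measurePreserving_inv _)
    exact h1.measureReal_preimage hB.nullMeasurableSet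
  have hm : MeasurableSet ((fun y : G => y⁻¹ * x) ⁻¹' B) := by
    have : Measurable fun y : G => y⁻¹ * x := (continuous_inv.mul continuous_const).measurable
    exact this hB
  have hne : (A ∩ (fun y => y⁻¹ * x) ⁻¹' B).Nonempty := by
    by_contra hne
    rw [Set.not_nonempty_iff_eq_empty, ← Set.disjoint_iff_inter_eq_empty] at hne
    have h2 := measureReal_union (μ := haarProb G) hne hm
    have h3 : (haarProb G).real (A ∪ (fun y => y⁻¹ * x) ⁻¹' B) ≤ 1 := measureReal_le_one
    linarith
  obtain ⟨y, hyA, hyB⟩ := hne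
  exact Set.mem_mul.2 ⟨y, hyA, y⁻¹ * x, hyB, by group⟩

/-- Replacing `g` by `h` changes the measure by at most that of `kA \ A` with `k = h⁻¹g` or `g⁻¹h`,
which tends to 0 as `k → 1` because `A` is compact. -/
theorem continuous_measureReal_inter_smul {A : Set G} (hA : IsCompact A) :
    Continuous fun g : G => (haarProb G).real (A ∩ g • A) := by
  have hAc : ∀ g : G, IsCompact (g • A) := fun g => hA.smul g
  have hAm : ∀ g : G, MeasurableSet (g • A) := fun g => (hAc g).isClosed.measurableSet
  have key : ∀ g h : G, (haarProb G).real (A ∩ g • A) ≤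
      (haarProb G).real (A ∩ h • A) + (haarProb G).real ((h⁻¹ * g) • A \ A) := by
    intro g h
    have h1 : A ∩ g • A ⊆ (A ∩ h • A) ∪ h • ((h⁻¹ * g) • A \ A) := by
      rintro x ⟨hx, hg⟩
      by_cases hh : x ∈ h • A
      · exact Or.inl ⟨hx, hh⟩
      · refine Or.inr ?_
        rw [Set.smul_set_sdiff, smul_smul, mul_inv_cancel_left]
        exact ⟨hg, hh⟩
    refine (measureReal_mono h1).trans ((measureReal_union_le _ _).trans ?_)
    rw [measureReal_def, measureReal_def, measureReal_def, measure_smul]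
  have lim : Filter.Tendsto (fun k : G => (haarProb G).real (k • A \ A)) (𝓝 1) (𝓝 0) := by
    have := (ENNReal.tendsto_toReal ENNReal.zero_ne_top).comp
      (tendsto_measure_smul_sdiff_isCompact_isClosed (μ := haarProb G) hA hA.isClosed)
    simpa [Function.comp_def, Measure.real] using this
  rw [continuous_iff_continuousAt]
  intro g
  have l1 : Filter.Tendsto (fun h : G => (haarProb G).real ((h⁻¹ * g) • A \ A)) (𝓝 g) (𝓝 0) := by
    refine lim.comp ?_
    have : Continuous fun h : G => h⁻¹ * g := by fun_prop
    simpa using this.tendsto g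
  have l2 : Filter.Tendsto (fun h : G => (haarProb G).real ((g⁻¹ * h) • A \ A)) (𝓝 g) (𝓝 0) := by
    refine lim.comp ?_
    have : Continuous fun h : G => g⁻¹ * h := by fun_prop
    simpa using this.tendsto g
  refine tendsto_of_tendsto_of_tendsto_of_le_of_le
    (g := fun h => (haarProb G).real (A ∩ g • A) - (haarProb G).real ((h⁻¹ * g) • A \ A))
    (h := fun h => (haarProb G).real (A ∩ g • A) + (haarProb G).real ((g⁻¹ * h) • A \ A))
    ?_ ?_ (fun h => ?_) (fun h => ?_)
  · simpa using l1.const_sub ((haarProb G).real (A ∩ g • A))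
  · simpa using l2.const_add ((haarProb G).real (A ∩ g • A))
  · have := key g h
    simp only
    linarith
  · exact key h g

/-- By Fubini the average over `g` of `m(A ∩ gA)` is `m(A)²`, and some value is at most the average.
-/
theorem exists_measureReal_inter_smul_le {A : Set G} [SecondCountableTopology G]
    (hA : IsCompact A) :
    ∃ g : G, (haarProb G).real (A ∩ g • A) ≤ (haarProb G).real A ^ 2 := by
  have hAm : MeasurableSet A := hA.isClosed.measurableSet
  have hSm : MeasurableSet {x : G × G | x.2 ∈ A ∧ x.1⁻¹ * x.2 ∈ A} := by
    have h1 : Measurable fun x : G × G => x.1⁻¹ * x.2 :=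
      (by fun_prop : Continuous fun x : G × G => x.1⁻¹ * x.2).measurable
    exact (measurable_snd hAm).inter (h1 hAm)
  have h1 : ∫⁻ g, haarProb G (A ∩ g • A) ∂(haarProb G) = haarProb G A * haarProb G A := by
    have e1 := Measure.prod_apply (μ := haarProb G) (ν := haarProb G) hSm
    have e2 := Measure.prod_apply_symm (μ := haarProb G) (ν := haarProb G) hSm
    have e3 : ∀ g : G, Prod.mk g ⁻¹' {x : G × G | x.2 ∈ A ∧ x.1⁻¹ * x.2 ∈ A} = A ∩ g • A := by
      intro g; ext x
      simp [Set.mem_smul_set_iff_inv_smul_mem]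
    have e4 : ∀ y : G, haarProb G ((fun x => (x, y)) ⁻¹' {x : G × G | x.2 ∈ A ∧ x.1⁻¹ * x.2 ∈ A})
        = A.indicator (fun _ => haarProb G A) y := by
      intro y
      by_cases hy : y ∈ A
      · have h1 : MeasurePreserving (fun x : G => x⁻¹ * y) (haarProb G) (haarProb G) :=
          (measurePreserving_mul_right _ y).comp (Measure.measurePreserving_inv _)
        simpa [hy, Set.preimage] using h1.measure_preimage hAm.nullMeasurableSet
      · simp [hy]
    simp only [e3] at e1
    simp only [e4] at e2
    rw [← e1, e2, lintegral_indicator hAm]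
    simp
  obtain ⟨g, hg⟩ := exists_le_lintegral (μ := haarProb G) (f := fun g => haarProb G (A ∩ g • A)) (by
    exact (measurable_measure_prodMk_left hSm).aemeasurable.congr (by
      refine Filter.Eventually.of_forall fun g => ?_
      simp only
      congr 1
      ext x
      simp [Set.mem_smul_set_iff_inv_smul_mem]))
  refine ⟨g, ?_⟩
  rw [h1] at hg
  have := ENNReal.toReal_mono (by finiteness) hg
  rw [ENNReal.toReal_mul] at this
  simpa [sq, Measure.real] using this

/-- The intermediate value theorem, between a below-average translate and `g = 1`. This is where
connectedness enters Kemperman's inequality. -/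
theorem exists_measureReal_inter_smul_eq [SecondCountableTopology G] [PreconnectedSpace G]
    {A : Set G} (hA : IsCompact A) {c : ℝ} (h1 : (haarProb G).real A ^ 2 ≤ c)
    (h2 : c ≤ (haarProb G).real A) : ∃ g : G, (haarProb G).real (A ∩ g • A) = c := by
  obtain ⟨g, hg⟩ := exists_measureReal_inter_smul_le hA
  have := mem_range_of_exists_le_of_exists_ge (continuous_measureReal_inter_smul hA)
    ⟨g, hg.trans h1⟩ ⟨1, by simpa using h2⟩
  exact this

theorem submodular_mul {A B : Set G} (hA : IsCompact A) (hB : IsCompact B) (g : G) :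
    (haarProb G).real ((A ∩ g • A) * B) + (haarProb G).real ((A ∪ g • A) * B) ≤
      2 * (haarProb G).real (A * B) := by
  have hAB := hA.mul hB
  have h1 : (A ∩ g • A) * B ⊆ A * B ∩ g • (A * B) := by
    rw [← smul_mul_assoc]
    exact Set.inter_mul_subset
  have h2 : (A ∪ g • A) * B = A * B ∪ g • (A * B) := by
    rw [← smul_mul_assoc, Set.union_mul]
  have h3 := measureReal_union_add_inter (μ := haarProb G) (s := A * B)
    (hAB.smul g).isClosed.measurableSet
  have h4 : (haarProb G).real (g • (A * B)) = (haarProb G).real (A * B) := by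
    rw [measureReal_def, measure_smul, measureReal_def]
  have h5 := measureReal_mono (μ := haarProb G) h1
  rw [h2]
  linarith

theorem measureReal_inter_add_union {A : Set G} (hA : IsCompact A) (g : G) :
    (haarProb G).real (A ∩ g • A) + (haarProb G).real (A ∪ g • A) =
      2 * (haarProb G).real A := by
  have h3 := measureReal_union_add_inter (μ := haarProb G) (s := A) (hA.smul g).isClosed.measurableSet
  have h4 : (haarProb G).real (g • A) = (haarProb G).real A := by
    rw [measureReal_def, measure_smul, measureReal_def]
  linarith

theorem measureReal_right_le_mul {A B : Set G} (hA : A.Nonempty) :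
    (haarProb G).real B ≤ (haarProb G).real (A * B) := by
  obtain ⟨a, ha⟩ := hA
  have h1 : (haarProb G).real ((fun x => a⁻¹ * x) ⁻¹' B) = (haarProb G).real B := by
    rw [measureReal_def, measure_preimage_mul, measureReal_def]
  rw [← h1]
  refine measureReal_mono fun x hx => Set.mem_mul.2 ⟨a, ha, _, hx, by group⟩

/-- Kemperman's inequality for compact subsets of a compact connected group. -/
theorem kemperman_of_isCompact [SecondCountableTopology G] [PreconnectedSpace G] {A B : Set G}
    (hA : IsCompact A) (hB : IsCompact B) (hAne : A.Nonempty)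
    (hbpos : 0 < (haarProb G).real B)
    (hle : (haarProb G).real A + (haarProb G).real B ≤ 1) :
    (haarProb G).real A + (haarProb G).real B ≤ (haarProb G).real (A * B) := by
  set m := (haarProb G).real with hm
  have hBne : B.Nonempty := by
    rw [Set.nonempty_iff_ne_empty]; rintro rfl; simp [hm] at hbpos
  by_contra! hlt
  set b := m B with hb
  have hb1 : b ≤ 1 := by have : 0 ≤ m A := measureReal_nonneg; linarith
  -- The defect is at least `3η`, so near-minimizers of `f` below have value under `b - 2η`; sets
  -- that are too small or too large have value at least `b - 2η`.
  obtain ⟨η, hη0, hη1, hη2⟩ : ∃ η : ℝ, 0 < η ∧ η ≤ b / 2 ∧ m (A * B) - m A ≤ b - 3 * η := by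
    refine ⟨min (b / 2) ((m A + b - m (A * B)) / 3), lt_min (by linarith) (by linarith),
      min_le_left _ _, ?_⟩
    have := min_le_right (b / 2) ((m A + b - m (A * B)) / 3)
    linarith
  let D : Set (Set G) := {S | IsCompact S ∧ S.Nonempty ∧ m S ≤ 1 - b + η}
  -- The term `-η m(S)²` makes the functional strictly submodular: replacing `S` by `S ∩ gS` and `S
  -- ∪ gS`, of measures `m(S) ∓ d`, lowers the sum of values by at least `2ηd²`. A minimizer within
  -- `ηd²` of the infimum, with `d = ηb`, is then impossible, so no attained minimum is needed.
  let f : Set G → ℝ := fun S => m (S * B) - m S - η * m S ^ 2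
  have hnn : ∀ S, 0 ≤ m S := fun S => measureReal_nonneg
  have hl1 : ∀ S, m S ≤ 1 := fun S => measureReal_le_one
  have hsq : ∀ S, η * m S ^ 2 ≤ η := fun S => by
    have := pow_le_one₀ (n := 2) (hnn S) (hl1 S)
    nlinarith
  have hbdd : BddBelow (f '' D) := by
    refine ⟨-1 - η, ?_⟩
    rintro _ ⟨S, -, rfl⟩
    have := hnn (S * B)
    have := hl1 S
    have := hsq S
    simp only [f]
    linarith
  have hAD : A ∈ D := ⟨hA, hAne, by linarith⟩
  have hinf : ∀ S ∈ D, sInf (f '' D) ≤ f S := fun S hS => csInf_le hbdd ⟨S, hS, rfl⟩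
  have hinfA : sInf (f '' D) ≤ b - 3 * η := by
    have h1 := hinf A hAD
    have h2 : 0 ≤ η * m A ^ 2 := by positivity
    simp only [f] at h1
    linarith
  have hd : 0 < η * (η * b) ^ 2 := by positivity
  obtain ⟨_, ⟨S, ⟨hSc, hSne, hSm⟩, rfl⟩, hS⟩ :=
    exists_lt_of_csInf_lt (s := f '' D) ⟨_, A, hAD, rfl⟩
      (show sInf (f '' D) < min (sInf (f '' D) + η * (η * b) ^ 2) (b - 2 * η) from
        lt_min (by linarith) (by linarith))
  have hS1 := hS.trans_le (min_le_left _ _)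
  have hS2 := hS.trans_le (min_le_right _ _)
  have hSlow : η ≤ m S := by
    by_contra! hlow
    have h1 : b ≤ m (S * B) := measureReal_right_le_mul hSne
    have := hsq S
    simp only [f] at hS2
    linarith
  have hShigh : m S ≤ 1 - b := by
    by_contra! hhigh
    have h1 : S * B = Set.univ := mul_eq_univ_of_one_lt_add
      hB.isClosed.measurableSet (by show 1 < m S + m B; linarith)
    have h2 : m (S * B) = 1 := by rw [h1]; simp [hm]
    have := hsq S
    simp only [f] at hS2
    linarith
  have hηb : 0 < η * b := by positivity
  have hηbη : η * b ≤ η := by nlinarith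
  have hηbη' : η * b < η := by nlinarith
  -- Admissible since `m(S) ≥ η` and `1 - m(S) ≥ b` give `m(S) - m(S)² ≥ ηb`. The slack `η` in the
  -- definition of `D` leaves room for the union.
  obtain ⟨g, hg⟩ := exists_measureReal_inter_smul_eq hSc (c := m S - η * b)
    (by show m S ^ 2 ≤ _; nlinarith) (by show _ ≤ m S; linarith)
  change m (S ∩ g • S) = _ at hg
  have hU : m (S ∪ g • S) = m S + η * b := by
    have : m (S ∩ g • S) + m (S ∪ g • S) = 2 * m S := measureReal_inter_add_union hSc g
    linarith
  have hI1 : S ∩ g • S ∈ D := by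
    refine ⟨hSc.inter (hSc.smul g), ?_, by linarith⟩
    rw [Set.nonempty_iff_ne_empty]
    intro h0
    rw [h0] at hg
    have : m ∅ = 0 := by simp [hm]
    linarith
  have hU1 : S ∪ g • S ∈ D := ⟨hSc.union (hSc.smul g), hSne.inl, by linarith⟩
  have i1 := hinf _ hI1
  have i2 := hinf _ hU1
  have i3 : m ((S ∩ g • S) * B) + m ((S ∪ g • S) * B) ≤ 2 * m (S * B) := submodular_mul hSc hB g
  simp only [f, hg, hU] at i1 i2 hS1
  nlinarith

/-- Kemperman's inequality in compact connected groups. -/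
theorem kemperman [SecondCountableTopology G] [PreconnectedSpace G] {A B : Set G}
    (hA : MeasurableSet A) (hB : MeasurableSet B)
    (hapos : 0 < haarProb G A) (hbpos : 0 < haarProb G B)
    (hle : haarProb G A + haarProb G B ≤ 1) :
    haarProb G A + haarProb G B ≤ haarProb G (A * B) := by
  have reg : ∀ S : Set G, MeasurableSet S → 0 < haarProb G S → ∀ ε : ℝ, 0 < ε →
      ∃ K ⊆ S, IsCompact K ∧ 0 < (haarProb G).real K ∧
        (haarProb G).real S ≤ (haarProb G).real K + ε := by
    intro S hS hpos ε hε
    have hmin : 0 < min ε ((haarProb G).real S) :=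
      lt_min hε (ENNReal.toReal_pos hpos.ne' (by finiteness))
    obtain ⟨K, hKS, hK, hlt⟩ := hS.exists_isCompact_lt_add (μ := haarProb G) (by finiteness)
      (ε := ENNReal.ofReal (min ε ((haarProb G).real S))) (ENNReal.ofReal_pos.2 hmin).ne'
    have h1 := (ENNReal.toReal_lt_toReal (by finiteness) (by finiteness)).2 hlt
    rw [ENNReal.toReal_add (by finiteness) (by finiteness), ENNReal.toReal_ofReal hmin.le] at h1
    have h2 := min_le_left ε ((haarProb G).real S)
    have h3 := min_le_right ε ((haarProb G).real S)
    refine ⟨K, hKS, hK, ?_, ?_⟩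
    · simp only [Measure.real] at *; linarith
    · simp only [Measure.real] at *; linarith
  have hle' : (haarProb G).real A + (haarProb G).real B ≤ 1 := by
    have := ENNReal.toReal_mono (by finiteness) hle
    rwa [ENNReal.toReal_add (by finiteness) (by finiteness), ENNReal.toReal_one] at this
  suffices h : (haarProb G).real A + (haarProb G).real B ≤ (haarProb G).real (A * B) by
    rw [← ENNReal.toReal_le_toReal (by finiteness) (by finiteness),
      ENNReal.toReal_add (by finiteness) (by finiteness)]
    exact h
  refine le_of_forall_pos_le_add fun ε hε => ?_
  obtain ⟨K, hKA, hK, hKpos, hKm⟩ := reg A hA hapos (ε / 2) (by linarith)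
  obtain ⟨L, hLB, hL, hLpos, hLm⟩ := reg B hB hbpos (ε / 2) (by linarith)
  have hKne : K.Nonempty := by
    rw [Set.nonempty_iff_ne_empty]; rintro rfl; simp at hKpos
  have k1 := measureReal_mono (μ := haarProb G) hKA
  have k2 := measureReal_mono (μ := haarProb G) hLB
  have k3 := kemperman_of_isCompact hK hL hKne hLpos (by linarith)
  have k4 := measureReal_mono (μ := haarProb G) (Set.mul_subset_mul hKA hLB)
  linarith

end Kemperman

/-! ### Arcs and injective endomorphisms of the circle -/

section CircleGroup

open Real

theorem haarProb_circle : haarProb Circle =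
    (ENNReal.ofReal (2 * π))⁻¹ • (volume.restrict (Set.Ioc (-π) π)).map Circle.exp := by
  have : Fact (0 < 2 * π) := ⟨two_pi_pos⟩
  let h := AddCircle.homeomorphCircle'
  have hhaar : (AddCircle.haarAddCircle (T := 2 * π)).map h = haarProb Circle := by
    have hp : IsProbabilityMeasure ((AddCircle.haarAddCircle (T := 2 * π)).map h) :=
      Measure.isProbabilityMeasure_map h.continuous.measurable.aemeasurable
    have hl : ((AddCircle.haarAddCircle (T := 2 * π)).map h).IsMulLeftInvariant := by
      refine ⟨fun z => ?_⟩
      obtain ⟨w, rfl⟩ := h.surjective z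
      rw [Measure.map_map (by fun_prop) h.continuous.measurable]
      have : (fun x => h w * x) ∘ h = h ∘ (fun x => w + x) := by
        funext x
        induction w using QuotientAddGroup.induction_on
        induction x using QuotientAddGroup.induction_on
        simp only [Function.comp_apply]
        exact (Circle.exp_add _ _).symm
      rw [this, ← Measure.map_map h.continuous.measurable (by fun_prop), map_add_left_eq_self]
    have := Measure.isHaarMeasure_of_isCompact_nonempty_interior
      ((AddCircle.haarAddCircle (T := 2 * π)).map h) Set.univ isCompact_univ (by simp)
        (by simp) (by simp)
    exact Measure.isHaarMeasure_eq_of_isProbabilityMeasure _ _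
  have h1 := (AddCircle.measurePreserving_mk (2 * π) (-π)).map_eq
  rw [show -π + 2 * π = π by ring, AddCircle.volume_eq_smul_haarAddCircle] at h1
  have h2 : (Circle.exp : ℝ → Circle) = h ∘ ((↑) : ℝ → AddCircle (2 * π)) := rfl
  rw [h2, ← Measure.map_map h.continuous.measurable (AddCircle.measurable_mk'), h1,
    Measure.map_smul, hhaar, smul_smul, ENNReal.inv_mul_cancel (by simpa using pi_pos) ENNReal.ofReal_ne_top,
    one_smul]

/-- The closed symmetric arc of half-length `r`. -/
def symmArc (r : ℝ) : Set Circle := Circle.exp '' Set.Icc (-r) r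

theorem isCompact_symmArc (r : ℝ) : IsCompact (symmArc r) :=
  isCompact_Icc.image (map_continuous Circle.exp)

theorem measurableSet_symmArc (r : ℝ) : MeasurableSet (symmArc r) :=
  (isCompact_symmArc r).isClosed.measurableSet

theorem inv_mem_symmArc {r : ℝ} {z : Circle} : z⁻¹ ∈ symmArc r ↔ z ∈ symmArc r := by
  have : ∀ z : Circle, z ∈ symmArc r → z⁻¹ ∈ symmArc r := by
    rintro _ ⟨x, hx, rfl⟩
    exact ⟨-x, ⟨by linarith [hx.2], by linarith [hx.1]⟩, by simp⟩
  exact ⟨fun h => by simpa using this _ h, this z⟩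

theorem symmArc_mul_symmArc {r s : ℝ} (hr : 0 ≤ r) (hs : 0 ≤ s) :
    symmArc r * symmArc s = symmArc (r + s) := by
  ext z
  constructor
  · rintro ⟨_, ⟨x, hx, rfl⟩, _, ⟨y, hy, rfl⟩, rfl⟩
    exact ⟨x + y, ⟨by linarith [hx.1, hy.1], by linarith [hx.2, hy.2]⟩, Circle.exp_add _ _⟩
  · rintro ⟨x, hx, rfl⟩
    refine Set.mem_mul.2 ⟨Circle.exp (max (-r) (min r x)), ⟨_, ⟨le_max_left _ _, ?_⟩, rfl⟩,
      Circle.exp (x - max (-r) (min r x)), ⟨_, ⟨?_, ?_⟩, rfl⟩, ?_⟩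
    · exact max_le (by linarith) (min_le_left _ _)
    · rcases max_cases (-r) (min r x) with h | h <;> rcases min_cases r x with h' | h' <;>
        linarith [hx.1, hx.2]
    · rcases max_cases (-r) (min r x) with h | h <;> rcases min_cases r x with h' | h' <;>
        linarith [hx.1, hx.2]
    · rw [← Circle.exp_add]; congr 1; ring

theorem exp_preimage_symmArc_inter {r : ℝ} (hr : r < π) :
    Circle.exp ⁻¹' symmArc r ∩ Set.Ioc (-π) π = Set.Icc (-r) r := by
  ext x
  constructor
  · rintro ⟨⟨y, hy, hyx⟩, hx⟩
    have := Circle.exp_injOn_Ioc (a := -π) (b := π) (by linarith)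
      (⟨by linarith [hy.1], by linarith [hy.2]⟩ : y ∈ Set.Ioc (-π) π) hx hyx
    rwa [← this]
  · intro hx
    exact ⟨⟨x, hx, rfl⟩, by linarith [hx.1], by linarith [hx.2]⟩

theorem haarProb_symmArc {r : ℝ} (hr : r < π) :
    haarProb Circle (symmArc r) = ENNReal.ofReal (r / π) := by
  rw [haarProb_circle, Measure.smul_apply,
    Measure.map_apply (map_continuous Circle.exp).measurable (measurableSet_symmArc r),
    Measure.restrict_apply ((map_continuous Circle.exp).measurable (measurableSet_symmArc r)),
    exp_preimage_symmArc_inter hr, Real.volume_Icc, smul_eq_mul,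
    ← ENNReal.ofReal_inv_of_pos two_pi_pos, ← ENNReal.ofReal_mul (by positivity)]
  congr 1
  field_simp
  ring

theorem symmArc_eq_univ {r : ℝ} (hr : π ≤ r) : symmArc r = Set.univ := by
  refine Set.eq_univ_of_forall fun z => ?_
  refine ⟨Complex.arg z, ⟨?_, (Complex.arg_le_pi _).trans hr⟩, Circle.exp_arg z⟩
  linarith [Complex.neg_pi_lt_arg (z : ℂ)]

/-- This Fourier coefficient is nonzero for `0 < r < π`; all the rigidity statements rest on that.
-/
theorem setIntegral_symmArc {r : ℝ} (h0 : 0 ≤ r) (hr : r < π) :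
    ∫ z in symmArc r, (z : ℂ) ∂(haarProb Circle) = ((sin r / π : ℝ) : ℂ) := by
  have hexp : Measurable Circle.exp := (map_continuous Circle.exp).measurable
  rw [haarProb_circle, Measure.restrict_smul, integral_smul_measure,
    Measure.restrict_map hexp (measurableSet_symmArc r),
    integral_map hexp.aemeasurable (by
      exact (by fun_prop : Continuous fun z : Circle => (z : ℂ)).aestronglyMeasurable),
    Measure.restrict_restrict (hexp (measurableSet_symmArc r)), exp_preimage_symmArc_inter hr,
    integral_Icc_eq_integral_Ioc, ← intervalIntegral.integral_of_le (by linarith)]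
  simp only [Circle.coe_exp]
  have h1 : ∀ x : ℝ, Complex.exp (x * Complex.I) = Complex.exp (Complex.I * x) := fun x => by
    rw [mul_comm]
  simp only [h1]
  rw [integral_exp_mul_complex Complex.I_ne_zero, ENNReal.toReal_inv,
    ENNReal.toReal_ofReal two_pi_pos.le]
  have h2 : (sin r : ℂ) = Complex.sin r := Complex.ofReal_sin r
  push_cast
  rw [Complex.sin, Complex.real_smul]
  have hpi : (π : ℂ) ≠ 0 := by exact_mod_cast pi_ne_zero
  have hI := Complex.I_ne_zero
  push_cast
  field_simp
  rw [Complex.I_sq, neg_mul_comm]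
  ring_nf

/-- Lifting `φ` through the covering `Circle.exp` gives a continuous additive, hence linear, map of
the line. Periodicity makes its slope an integer `k`, and injectivity forces `k = ±1`. -/
theorem circle_hom_eq_id_or_inv (φ : Circle →* Circle) (hφ : Continuous φ)
    (hinj : Function.Injective φ) : (∀ z, φ z = z) ∨ ∀ z, φ z = z⁻¹ := by
  let f : C(ℝ, Circle) := ⟨fun x => φ (Circle.exp x), by fun_prop⟩
  obtain ⟨F, ⟨hF0, hF⟩, hu⟩ :=
    Circle.isCoveringMap_exp.existsUnique_continuousMap_lifts f 0 0 (by simp [f])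
  have hF' : ∀ x, Circle.exp (F x) = φ (Circle.exp x) := fun x => congrFun hF x
  have hadd : ∀ x y, F (x + y) = F x + F y := by
    intro x y
    have := hu ⟨fun x => F (x + y) - F y, by fun_prop⟩ ⟨by simp, by
      funext x
      simp [f, Circle.exp_sub, hF', Circle.exp_add]⟩
    have h := congrArg (fun K : C(ℝ, ℝ) => K x) this
    simp only [ContinuousMap.coe_mk] at h
    linarith
  let L : ℝ →+ ℝ := ⟨⟨F, hF0⟩, hadd⟩
  let L' : ℝ →L[ℝ] ℝ := L.toRealLinearMap F.continuous
  have hlin : ∀ x, F x = x * F 1 := by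
    intro x
    have : L' (x • (1 : ℝ)) = x • L' 1 := map_smul _ _ _
    simpa [L', L] using this
  obtain ⟨k, hk⟩ : ∃ k : ℤ, F 1 = k := by
    have h1 : Circle.exp (F (2 * π)) = 1 := by rw [hF']; simp
    obtain ⟨n, hn⟩ := Circle.exp_eq_one.1 h1
    rw [hlin] at hn
    exact ⟨n, by have := pi_pos; field_simp at hn; linarith⟩
  have hk0 : (k : ℝ) ≠ 0 := by
    intro h0
    have h1 : φ (Circle.exp 1) = φ 1 := by rw [← hF', hk, h0]; simp
    obtain ⟨n, hn⟩ := Circle.exp_eq_one.1 (hinj h1)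
    have h3 := pi_gt_three
    rcases lt_trichotomy n 0 with h | h | h
    · have : (n : ℝ) ≤ 0 := by exact_mod_cast h.le
      nlinarith
    · subst h; simp at hn
    · have : (1 : ℝ) ≤ n := by exact_mod_cast h
      nlinarith
  have hk1 : IsUnit k := by
    -- The `k`-th root of unity `exp (2π / k)` lies in the kernel, so it is trivial and `k` divides
    -- 1.
    have h1 : φ (Circle.exp (2 * π / k)) = φ 1 := by
      rw [← hF', hlin, hk, div_mul_cancel₀ _ hk0]; simp
    obtain ⟨n, hn⟩ := Circle.exp_eq_one.1 (hinj h1)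
    have : (n * k : ℝ) = 1 := by
      have := pi_pos
      field_simp at hn
      linarith
    exact IsUnit.of_mul_eq_one n (by rw [mul_comm]; exact_mod_cast this)
  have hz : ∀ z, φ z = Circle.exp (Complex.arg z * k) := fun z => by
    rw [← hk, ← hlin, hF', Circle.exp_arg]
  rcases Int.isUnit_iff.1 hk1 with h | h
  · left; intro z; simp [hz, h]
  · right; intro z; simp [hz, h]

end CircleGroup

/-! ### Rigidity of characters and arc centres -/

section Characters

set_option linter.unusedSectionVars false

open Real

variable {N : Type*} [Group N] [TopologicalSpace N] [IsTopologicalGroup N]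
  [CompactSpace N] [MeasurableSpace N] [BorelSpace N]

theorem ContinuousMonoidHom.haarProb_measurePreserving (ξ : N →ₜ* Circle)
    (hξ : Function.Surjective ξ) : MeasurePreserving ξ (haarProb N) (haarProb Circle) :=
  _root_.haarProb_measurePreserving ξ.toMonoidHom ξ.continuous_toFun hξ

theorem preimage_mul_symmArc_mul_singleton (r : ℝ) (a : Circle) :
    (fun z => z * a) ⁻¹' (symmArc r * {a}) = symmArc r := by
  ext z; simp

theorem measurableSet_symmArc_mul_singleton (r : ℝ) (a : Circle) :
    MeasurableSet (symmArc r * {a}) :=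
  ((isCompact_symmArc r).mul isCompact_singleton).isClosed.measurableSet

theorem measurableSet_preimage_symmArc (ξ : N →ₜ* Circle) (r : ℝ) (a : Circle) :
    MeasurableSet (ξ ⁻¹' (symmArc r * {a})) :=
  ξ.continuous_toFun.measurable (measurableSet_symmArc_mul_singleton r a)

theorem haarProb_preimage_symmArc (ξ : N →ₜ* Circle) (hξ : Function.Surjective ξ)
    (r : ℝ) (a : Circle) :
    haarProb N (ξ ⁻¹' (symmArc r * {a})) = haarProb Circle (symmArc r) := by
  rw [(ξ.haarProb_measurePreserving hξ).measure_preimage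
    (measurableSet_symmArc_mul_singleton r a).nullMeasurableSet,
    ← measure_preimage_mul_right _ a, preimage_mul_symmArc_mul_singleton]

theorem setIntegral_preimage_symmArc (ξ : N →ₜ* Circle) (hξ : Function.Surjective ξ)
    {r : ℝ} (h0 : 0 ≤ r) (hr : r < π) (a : Circle) :
    ∫ n in ξ ⁻¹' (symmArc r * {a}), (ξ n : ℂ) ∂(haarProb N) = a * ((sin r / π : ℝ) : ℂ) := by
  have hmp := ξ.haarProb_measurePreserving hξ
  have hc : Continuous fun z : Circle => (z : ℂ) := by fun_prop
  have h1 := setIntegral_map (μ := haarProb N) (measurableSet_symmArc_mul_singleton r a)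
    (f := fun z : Circle => (z : ℂ)) hc.aestronglyMeasurable hmp.measurable.aemeasurable
  rw [hmp.map_eq] at h1
  have h2 := (measurePreserving_mul_right (haarProb Circle) a).setIntegral_preimage_emb
    (measurableEmbedding_mulRight a) (fun z : Circle => (z : ℂ)) (symmArc r * {a})
  rw [preimage_mul_symmArc_mul_singleton] at h2
  rw [← h1, ← h2, ← setIntegral_symmArc h0 hr, ← integral_const_mul]
  refine integral_congr_ae (Filter.Eventually.of_forall fun z => ?_)
  simp [mul_comm]

theorem sin_div_pi_ne_zero {r : ℝ} (h0 : 0 < r) (hr : r < π) : ((sin r / π : ℝ) : ℂ) ≠ 0 := by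
  have := div_pos (sin_pos_of_pos_of_lt_pi h0 hr) pi_pos
  exact_mod_cast this.ne'

theorem eq_of_preimage_symmArc_ae_eq (ξ : N →ₜ* Circle) (hξ : Function.Surjective ξ)
    {r : ℝ} (h0 : 0 < r) (hr : r < π) {a b : Circle}
    (h : ξ ⁻¹' (symmArc r * {a}) =ᵐ[haarProb N] ξ ⁻¹' (symmArc r * {b})) : a = b := by
  have h1 := setIntegral_congr_set (f := fun n => (ξ n : ℂ)) h
  rw [setIntegral_preimage_symmArc ξ hξ h0.le hr, setIntegral_preimage_symmArc ξ hξ h0.le hr] at h1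
  exact Circle.ext (mul_right_cancel₀ (sin_div_pi_ne_zero h0 hr) h1)

/-- Translation by `n ∈ ker η` preserves the right-hand set, so the integral of `ξ` over it is
multiplied by `ξ n`; but that integral is nonzero. -/
theorem ker_le_ker_of_preimage_symmArc_ae_eq (ξ η : N →ₜ* Circle) (hξ : Function.Surjective ξ)
    {r : ℝ} (h0 : 0 < r) (hr : r < π) {a b : Circle}
    (h : ξ ⁻¹' (symmArc r * {a}) =ᵐ[haarProb N] η ⁻¹' (symmArc r * {b})) {n : N} (hn : η n = 1) :
    ξ n = 1 := by
  have h1 := setIntegral_congr_set (f := fun n => (ξ n : ℂ)) h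
  rw [setIntegral_preimage_symmArc ξ hξ h0.le hr] at h1
  have h2 := (measurePreserving_mul_left (haarProb N) n).setIntegral_preimage_emb
    (measurableEmbedding_mulLeft n) (fun x => (ξ x : ℂ)) (η ⁻¹' (symmArc r * {b}))
  have h3 : (fun x => n * x) ⁻¹' (η ⁻¹' (symmArc r * {b})) = η ⁻¹' (symmArc r * {b}) := by
    ext x
    simp [hn]
  rw [h3] at h2
  simp only [map_mul, Circle.coe_mul] at h2
  rw [integral_const_mul, ← h1] at h2
  have h4 : (a : ℂ) * ((sin r / π : ℝ) : ℂ) ≠ 0 :=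
    mul_ne_zero a.coe_ne_zero (sin_div_pi_ne_zero h0 hr)
  exact Circle.ext (mul_right_cancel₀ h4 (by rw [h2]; simp))

/-- The kernels coincide, so `ξ` factors through `η` by an injective continuous endomorphism of the
circle. -/
theorem eq_or_eq_inv_of_preimage_symmArc_ae_eq (ξ η : N →ₜ* Circle)
    (hξ : Function.Surjective ξ) (hη : Function.Surjective η)
    {r : ℝ} (h0 : 0 < r) (hr : r < π) {a b : Circle}
    (h : ξ ⁻¹' (symmArc r * {a}) =ᵐ[haarProb N] η ⁻¹' (symmArc r * {b})) :
    (∀ n, ξ n = η n) ∨ ∀ n, ξ n = (η n)⁻¹ := by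
  have hker : η.toMonoidHom.ker ≤ ξ.toMonoidHom.ker := fun n hn =>
    ker_le_ker_of_preimage_symmArc_ae_eq ξ η hξ h0 hr h hn
  let φ : Circle →* Circle := η.toMonoidHom.liftOfSurjective hη ⟨ξ.toMonoidHom, hker⟩
  have hφ : ∀ n, φ (η n) = ξ n := fun n =>
    η.toMonoidHom.liftOfRightInverse_comp_apply _ _ ⟨ξ.toMonoidHom, hker⟩ n
  have hq : IsQuotientMap η :=
    η.continuous_toFun.isClosedMap.isQuotientMap η.continuous_toFun hη
  have hc : Continuous φ := by
    rw [hq.continuous_iff]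
    have : φ ∘ η = ξ := funext hφ
    rw [this]
    exact ξ.continuous_toFun
  have hinj : Function.Injective φ := by
    rw [injective_iff_map_eq_one]
    intro z hz
    obtain ⟨n, rfl⟩ := hη z
    rw [hφ] at hz
    exact ker_le_ker_of_preimage_symmArc_ae_eq η ξ hη h0 hr h.symm hz
  rcases circle_hom_eq_id_or_inv φ hc hinj with h | h
  · exact Or.inl fun n => by rw [← hφ, h]
  · exact Or.inr fun n => by rw [← hφ, h]

end Characters

/-! ### From strict reduction to a character with sharp arcs -/

section Reduction

set_option linter.unusedSectionVars false

open Real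

variable {N : Type*} [Group N] [TopologicalSpace N] [IsTopologicalGroup N]
  [CompactSpace N] [MeasurableSpace N] [BorelSpace N]

/-- A connected group has no nontrivial image in a compact group of automorphisms of the circle. -/
theorem semi_right_apply_of_connected [PreconnectedSpace N] (K : CompactAutSubgroup Circle)
    (p : N →* K.Semi) (hp : Continuous p) (n : N) (z : Circle) :
    ((p n).right : MulAut Circle) z = z := by
  have hid : ∀ n : N, (∀ z, ((p n).right : MulAut Circle) z = z) ∨
      ∀ z, ((p n).right : MulAut Circle) z = z⁻¹ := fun n =>
    circle_hom_eq_id_or_inv ((p n).right : MulAut Circle).toMonoidHom (K.continuous_apply _)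
      (MulEquiv.injective _)
  -- A point that is not its own inverse distinguishes the identity from inversion.
  let i : Circle := Circle.exp 1
  have hi : i⁻¹ ≠ i := by
    intro h
    have h1 : Circle.exp (-1) = Circle.exp 1 := by rw [Circle.exp_neg]; exact h
    have := Circle.exp_injOn_Ioc (a := -Real.pi) (b := Real.pi) (by linarith)
      ⟨by linarith [pi_gt_three], by linarith [pi_gt_three]⟩
      ⟨by linarith [pi_gt_three], by linarith [pi_gt_three]⟩ h1
    norm_num at this
  have hc : Continuous fun n : N => ((p n).right : MulAut Circle) i := by
    have h1 : Continuous fun x : K.Semi => (x.left, K.toContinuousMap x.right) :=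
      continuous_induced_dom
    exact (continuous_eval_const (F := C(Circle, Circle)) i).comp (continuous_snd.comp (h1.comp hp))
  -- Both this set and its complement, where `i` is inverted, are given by closed conditions.
  have hcl : IsClopen {n : N | ((p n).right : MulAut Circle) i = i} := by
    refine ⟨isClosed_eq hc continuous_const, ?_⟩
    have : {n : N | ((p n).right : MulAut Circle) i = i} =
        {n : N | ((p n).right : MulAut Circle) i = i⁻¹}ᶜ := by
      ext n
      rcases hid n with h | h
      · simp [h, hi.symm]
      · simp [h, hi]
    rw [this]
    exact (isClosed_eq hc continuous_const).isOpen_compl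
  have hu := hcl.eq_univ ⟨1, by simp⟩
  have hn : ((p n).right : MulAut Circle) i = i := Set.eq_univ_iff_forall.1 hu n
  rcases hid n with h | h
  · exact h z
  · exact absurd ((h i).symm.trans hn) hi

/-- Both members of a critical pair in a Kneser group are contained in preimages of arcs of the
same measure under one character. -/
theorem IsKneserGroup.exists_character (hN : IsKneserGroup N) {A B : Set N}
    (hAB : IsCriticalPair A B) :
    ∃ ξ : N →ₜ* Circle, Function.Surjective ξ ∧ ∃ a b : Circle,
      A ⊆ ξ ⁻¹' (symmArc (π * (haarProb N).real A) * {a}) ∧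
      B ⊆ ξ ⁻¹' (symmArc (π * (haarProb N).real B) * {b}) := by
  obtain ⟨hconn, hK⟩ := hN
  obtain ⟨_, _, ⟨r, hr, rfl⟩, ⟨s, hs, rfl⟩, hm, K, -, p, hp, hpsurj, u, v, hA, hB⟩ := hK A B hAB
  change haarProb N (A * B) = haarProb Circle (symmArc r * symmArc s) at hm
  have htriv := semi_right_apply_of_connected K p hp
  -- The projection to the circle factor is multiplicative because the `K`-component acts trivially.
  let ξ : N →ₜ* Circle :=
    { toFun := fun n => (p n).left
      map_one' := by simp
      map_mul' := fun x y => by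
        rw [map_mul, SemidirectProduct.mul_left]
        congr 1
        exact htriv x _
      continuous_toFun := by
        have h1 : Continuous fun x : K.Semi => (x.left, K.toContinuousMap x.right) :=
          continuous_induced_dom
        exact continuous_fst.comp (h1.comp hp) }
  have hξ : Function.Surjective ξ := fun z => by
    obtain ⟨n, hn⟩ := hpsurj (SemidirectProduct.inl z)
    exact ⟨n, by change (p n).left = z; rw [hn, SemidirectProduct.left_inl]⟩
  have hright : ∀ (k : K.Semi) (z : Circle), (k.right : MulAut Circle) z = z := fun k z => by
    obtain ⟨n, rfl⟩ := hpsurj k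
    exact htriv n z
  have hA' : A ⊆ ξ ⁻¹' (symmArc r * {u.left}) := by
    intro n hn
    obtain ⟨x, hx, hxn⟩ := hA hn
    refine Set.mem_mul.2 ⟨x.left, hx, u.left, rfl, ?_⟩
    change _ = (p n).left
    rw [← hxn, mul_comm]
    change _ = u.left * (u.right : MulAut Circle) x.left
    rw [hright]
  have hB' : B ⊆ ξ ⁻¹' (symmArc s * {v.left}) := by
    intro n hn
    obtain ⟨x, hx, hxn⟩ := hB hn
    refine Set.mem_mul.2 ⟨x.left, hx, v.left, rfl, ?_⟩
    change _ = (p n).left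
    rw [← hxn]
    change _ = x.left * (x.right : MulAut Circle) v.left
    rw [hright]
  rw [symmArc_mul_symmArc hr hs, hAB.measure_mul] at hm
  have hlt := hAB.sum_lt_one
  have hrs : r + s < π := by
    by_contra! h
    rw [symmArc_eq_univ h, measure_univ] at hm
    exact hlt.ne hm
  rw [haarProb_symmArc hrs] at hm
  have hmA := measure_mono (μ := haarProb N) hA'
  have hmB := measure_mono (μ := haarProb N) hB'
  rw [haarProb_preimage_symmArc ξ hξ, haarProb_symmArc (by linarith)] at hmA hmB
  have e := congrArg ENNReal.toReal hm
  have eA := ENNReal.toReal_mono (by finiteness) hmA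
  have eB := ENNReal.toReal_mono (by finiteness) hmB
  rw [ENNReal.toReal_add (by finiteness) (by finiteness),
    ENNReal.toReal_ofReal (by positivity)] at e
  rw [ENNReal.toReal_ofReal (by positivity)] at eA eB
  change (haarProb N).real A + (haarProb N).real B = _ at e
  change (haarProb N).real A ≤ _ at eA
  change (haarProb N).real B ≤ _ at eB
  have e3 : (r + s) / π = r / π + s / π := add_div _ _ _
  -- The bounds `m(A) ≤ r/π` and `m(B) ≤ s/π` have equal sums on both sides, so both are equalities.
  have e1 : r = π * (haarProb N).real A := by
    have : (haarProb N).real A = r / π := by linarith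
    rw [this]; field_simp
  have e2 : s = π * (haarProb N).real B := by
    have : (haarProb N).real B = s / π := by linarith
    rw [this]; field_simp
  exact ⟨ξ, hξ, u.left, v.left, e1 ▸ hA', e2 ▸ hB'⟩

end Reduction

/-! ### Sets filling an arc preimage, and their phase -/

section FullMeasure

set_option linter.unusedSectionVars false

open Real

/-- Used with `C` a product of slices and `T` a slice of `AB`. Neither need be Borel, so only outer
measures are compared and `T` is replaced by its measurable hull. -/
theorem ae_eq_toMeasurable_of_subset {α : Type*} [MeasurableSpace α] {μ : Measure α}
    [IsFiniteMeasure μ] {C E T : Set α} (hE : MeasurableSet E) (hCE : C ⊆ E) (hCT : C ⊆ T)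
    (h1 : μ E ≤ μ C) (h2 : μ T ≤ μ C) : E =ᵐ[μ] toMeasurable μ T := by
  have hm : MeasurableSet (E ∩ toMeasurable μ T) := hE.inter (measurableSet_toMeasurable _ _)
  have hC : μ C ≤ μ (E ∩ toMeasurable μ T) :=
    measure_mono (Set.subset_inter hCE (hCT.trans (subset_toMeasurable _ _)))
  have e1 := ae_eq_of_subset_of_measure_ge Set.inter_subset_left (h1.trans hC)
    hm.nullMeasurableSet (by finiteness)
  have e2 := ae_eq_of_subset_of_measure_ge Set.inter_subset_right
    ((measure_toMeasurable T).le.trans (h2.trans hC)) hm.nullMeasurableSet (by finiteness)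
  exact e1.symm.trans e2

variable {N : Type*} [Group N] [TopologicalSpace N] [IsTopologicalGroup N]
  [CompactSpace N] [MeasurableSpace N] [BorelSpace N]

theorem ae_eq_preimage_symmArc_of_subset {ξ : N →ₜ* Circle} (hξ : Function.Surjective ξ) {r : ℝ}
    (hr : r < π) {S : Set N} (hS : MeasurableSet S) (hm : haarProb N S = ENNReal.ofReal (r / π))
    {a : Circle} (h : S ⊆ ξ ⁻¹' (symmArc r * {a})) :
    S =ᵐ[haarProb N] ξ ⁻¹' (symmArc r * {a}) :=
  ae_eq_of_subset_of_measure_ge h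
    (by rw [haarProb_preimage_symmArc ξ hξ, haarProb_symmArc hr, hm]) hS.nullMeasurableSet
    (by finiteness)

theorem eq_or_eq_inv_of_subset_preimage {ξ η : N →ₜ* Circle} (hξ : Function.Surjective ξ)
    (hη : Function.Surjective η) {r : ℝ} (h0 : 0 < r) (hr : r < π) {S : Set N}
    (hS : MeasurableSet S) (hm : haarProb N S = ENNReal.ofReal (r / π)) {a b : Circle}
    (ha : S ⊆ ξ ⁻¹' (symmArc r * {a})) (hb : S ⊆ η ⁻¹' (symmArc r * {b})) :
    (∀ n, η n = ξ n) ∨ ∀ n, η n = (ξ n)⁻¹ :=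
  eq_or_eq_inv_of_preimage_symmArc_ae_eq η ξ hη hξ h0 hr
    ((ae_eq_preimage_symmArc_of_subset hη hr hS hm hb).symm.trans
      (ae_eq_preimage_symmArc_of_subset hξ hr hS hm ha))

theorem inv_mem_symmArc_mul_singleton {r : ℝ} {a z : Circle} :
    z⁻¹ ∈ symmArc r * {a} ↔ z ∈ symmArc r * {a⁻¹} := by
  simp only [Set.mul_singleton, Set.mem_image, ← eq_mul_inv_iff_mul_eq, exists_eq_right]
  rw [← inv_mem_symmArc]
  simp [mul_comm]

theorem exists_subset_preimage_of_eq_or_eq_inv {ξ η : N →ₜ* Circle}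
    (h : (∀ n, η n = ξ n) ∨ ∀ n, η n = (ξ n)⁻¹) {r : ℝ} {S : Set N} {b : Circle}
    (hb : S ⊆ η ⁻¹' (symmArc r * {b})) : ∃ c, S ⊆ ξ ⁻¹' (symmArc r * {c}) := by
  rcases h with h | h
  · exact ⟨b, fun n hn => by have := hb hn; rwa [Set.mem_preimage, h] at this⟩
  · exact ⟨b⁻¹, fun n hn => by
      have := hb hn
      rwa [Set.mem_preimage, h, inv_mem_symmArc_mul_singleton] at this⟩

/-- The direction in the circle of the integral of a character over a set. -/
noncomputable def characterPhase (ξ : N →ₜ* Circle) (S : Set N) : Circle :=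
  Circle.exp (Complex.arg (∫ n in S, (ξ n : ℂ) ∂(haarProb N)))

/-- The integral of `ξ` over `S` is a positive multiple of `a`. The centre is thus recovered
canonically from `S`, which makes its measurable choice possible. -/
theorem characterPhase_eq {ξ : N →ₜ* Circle} (hξ : Function.Surjective ξ) {r : ℝ} (h0 : 0 < r)
    (hr : r < π) {S : Set N} (hS : MeasurableSet S)
    (hm : haarProb N S = ENNReal.ofReal (r / π)) {a : Circle}
    (h : S ⊆ ξ ⁻¹' (symmArc r * {a})) : characterPhase ξ S = a := by
  rw [characterPhase, setIntegral_congr_set (ae_eq_preimage_symmArc_of_subset hξ hr hS hm h),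
    setIntegral_preimage_symmArc ξ hξ h0.le hr, mul_comm,
    Complex.arg_real_mul _ (div_pos (sin_pos_of_pos_of_lt_pi h0 hr) pi_pos), Circle.exp_arg]

theorem measurable_characterPhase {α : Type*} [MeasurableSpace α] (ξ : N →ₜ* Circle)
    {T : Set (α × N)} (hT : MeasurableSet T) :
    Measurable fun x => characterPhase ξ (Prod.mk x ⁻¹' T) := by
  have hc : Continuous fun n : N => (ξ n : ℂ) :=
    (by fun_prop : Continuous fun z : Circle => (z : ℂ)).comp ξ.continuous_toFun
  have h1 : StronglyMeasurable (T.indicator fun x : α × N => (ξ x.2 : ℂ)) :=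
    ((hc.measurable.comp measurable_snd).indicator hT).stronglyMeasurable
  have h2 := h1.integral_prod_right' (ν := haarProb N)
  have h3 : ∀ x, ∫ n, T.indicator (fun x : α × N => (ξ x.2 : ℂ)) (x, n) ∂(haarProb N) =
      ∫ n in Prod.mk x ⁻¹' T, (ξ n : ℂ) ∂(haarProb N) := fun x => by
    rw [← integral_indicator (measurable_prodMk_left hT)]
    rfl
  simp only [h3] at h2
  exact (map_continuous Circle.exp).measurable.comp (Complex.measurable_arg.comp h2.measurable)

end FullMeasure

/-! ### Slices along cosets of a normal subgroup -/

section NormalSubgroup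

set_option linter.unusedSectionVars false

open Real

variable {G : Type*} [Group G] (N : Subgroup G)

theorem mem_leftSlice {A : Set G} {p : G} {n : N} : n ∈ leftSlice N A p ↔ p * (n : G) ∈ A := by
  simp [leftSlice, Set.mem_smul_set_iff_inv_smul_mem]

theorem mem_rightSlice {B : Set G} {q : G} {n : N} :
    n ∈ rightSlice N B q ↔ (n : G) * q ∈ B := by
  simp [rightSlice]

variable [N.Normal]

theorem conjAut_coe (p : G) (n : N) : ((conjAut N p n : N) : G) = p * n * p⁻¹ := rfl

theorem conjAut_mul (p q : G) (n : N) : conjAut N (p * q) n = conjAut N p (conjAut N q n) := by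
  simp [conjAut]

theorem conjAut_inv_apply_self (p : G) (n : N) : conjAut N p⁻¹ (conjAut N p n) = n := by
  rw [← conjAut_mul]; simp [conjAut]

variable [TopologicalSpace G] [IsTopologicalGroup G]

/-- Conjugation by `p` as a continuous endomorphism of a normal subgroup. -/
def conjHom (p : G) : N →ₜ* N where
  toMonoidHom := (conjAut N p).toMonoidHom
  continuous_toFun := by
    refine Continuous.subtype_mk (f := fun n : N => p * (n : G) * p⁻¹) ?_ _
    fun_prop

theorem conjHom_apply (p : G) (n : N) : conjHom N p n = conjAut N p n := rfl

theorem conjHom_surjective (p : G) : Function.Surjective (conjHom N p) :=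
  (conjAut N p).surjective

variable [T2Space G] [CompactSpace G] [MeasurableSpace G] [BorelSpace G] [CompactSpace N]

theorem haarProb_preimage_conjHom (p : G) (S : Set N) :
    haarProb N (conjHom N p ⁻¹' S) = haarProb N S := by
  have hmp := haarProb_measurePreserving (conjHom N p).toMonoidHom (conjHom N p).continuous_toFun
    (conjHom_surjective N p)
  have hemb : IsClosedEmbedding (conjHom N p) :=
    (conjHom N p).continuous_toFun.isClosedEmbedding (conjAut N p).injective
  exact hmp.measure_preimage_emb hemb.measurableEmbedding S

theorem cosetMeasure_apply (x : G) (S : Set G) :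
    cosetMeasure N x S = haarProb N {n : N | (n : G) * x ∈ S} := by
  have hemb : IsClosedEmbedding fun n : N => (n : G) * x :=
    Continuous.isClosedEmbedding (by fun_prop) fun m n h => Subtype.ext (mul_right_cancel h)
  exact hemb.measurableEmbedding.map_apply _ _

/-- The slice uses left translation and the coset measure right translation; they differ by
conjugation by `p`, which preserves Haar measure. -/
theorem haarProb_leftSlice (A : Set G) (p : G) :
    haarProb N (leftSlice N A p) = cosetMeasure N p A := by
  rw [cosetMeasure_apply, ← haarProb_preimage_conjHom N p {n : N | (n : G) * p ∈ A}]
  congr 1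
  ext n
  rw [mem_leftSlice, Set.mem_preimage, Set.mem_ofPred_eq, conjHom_apply, conjAut_coe,
    inv_mul_cancel_right]

theorem haarProb_rightSlice (B : Set G) (q : G) :
    haarProb N (rightSlice N B q) = cosetMeasure N q B := by
  rw [cosetMeasure_apply]
  congr 1
  ext n
  rw [mem_rightSlice, Set.mem_ofPred_eq]

/-- This is the identity `(pm)(nq) = (p(mn)p⁻¹)(pq)`. -/
theorem leftSlice_mul_rightSlice_subset (A B : Set G) (p q : G) :
    leftSlice N A p * rightSlice N B q ⊆
      conjHom N p ⁻¹' {n : N | (n : G) * (p * q) ∈ A * B} := by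
  rintro _ ⟨m, hm, n, hn, rfl⟩
  rw [mem_leftSlice] at hm
  rw [mem_rightSlice] at hn
  rw [Set.mem_preimage, Set.mem_ofPred_eq, conjHom_apply, conjAut_coe]
  exact Set.mem_mul.2 ⟨_, hm, _, hn, by simp [mul_assoc]⟩

theorem measurableSet_leftSlice {A : Set G} (hA : MeasurableSet A) (p : G) :
    MeasurableSet (leftSlice N A p) := by
  have h : Measurable fun n : N => p * (n : G) :=
    (by fun_prop : Continuous fun n : N => p * (n : G)).measurable
  have e : leftSlice N A p = (fun n : N => p * (n : G)) ⁻¹' A := Set.ext fun n => mem_leftSlice N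
  rw [e]
  exact h hA

theorem measurableSet_rightSlice {B : Set G} (hB : MeasurableSet B) (q : G) :
    MeasurableSet (rightSlice N B q) := by
  have h : Measurable fun n : N => (n : G) * q :=
    (by fun_prop : Continuous fun n : N => (n : G) * q).measurable
  have e : rightSlice N B q = (fun n : N => (n : G) * q) ⁻¹' B :=
    Set.ext fun n => mem_rightSlice N
  rw [e]
  exact h hB

variable [SecondCountableTopology G]

theorem measurable_characterPhase_leftSlice (ξ : N →ₜ* Circle) {A : Set G}
    (hA : MeasurableSet A) : Measurable fun p : G => characterPhase ξ (leftSlice N A p) := by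
  have h : Measurable fun x : G × N => x.1 * (x.2 : G) :=
    (by fun_prop : Continuous fun x : G × N => x.1 * (x.2 : G)).measurable
  have e : ∀ p, leftSlice N A p = Prod.mk p ⁻¹' ((fun x : G × N => x.1 * (x.2 : G)) ⁻¹' A) :=
    fun p => Set.ext fun n => mem_leftSlice N
  simp only [e]
  exact measurable_characterPhase ξ (h hA)

theorem measurable_characterPhase_rightSlice (ξ : N →ₜ* Circle) {B : Set G}
    (hB : MeasurableSet B) : Measurable fun q : G => characterPhase ξ (rightSlice N B q) := by
  have h : Measurable fun x : G × N => (x.2 : G) * x.1 :=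
    (by fun_prop : Continuous fun x : G × N => (x.2 : G) * x.1).measurable
  have e : ∀ q, rightSlice N B q = Prod.mk q ⁻¹' ((fun x : G × N => (x.2 : G) * x.1) ⁻¹' B) :=
    fun q => Set.ext fun n => mem_rightSlice N
  simp only [e]
  exact measurable_characterPhase ξ (h hB)

/-- Slices whose coset measures add up on the product coset form a critical pair. -/
theorem isCriticalPair_slices [PreconnectedSpace N] {A B : Set G} (hA : MeasurableSet A)
    (hB : MeasurableSet B) {p q : G} (hp : 0 < cosetMeasure N p A) (hq : 0 < cosetMeasure N q B)
    (hsum : cosetMeasure N p A + cosetMeasure N q B < 1)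
    (hpq : cosetMeasure N (p * q) (A * B) = cosetMeasure N p A + cosetMeasure N q B) :
    IsCriticalPair (leftSlice N A p) (rightSlice N B q) := by
  have hAm := measurableSet_leftSlice N hA p
  have hBm := measurableSet_rightSlice N hB q
  have : SecondCountableTopology N := TopologicalSpace.Subtype.secondCountableTopology _
  rw [← haarProb_leftSlice] at hp
  rw [← haarProb_rightSlice] at hq
  rw [← haarProb_leftSlice, ← haarProb_rightSlice] at hsum
  rw [← haarProb_leftSlice N A, ← haarProb_rightSlice N B] at hpq
  -- Kemperman gives the lower bound; the slice of `AB` over `pq` gives the upper bound.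
  refine ⟨hAm, hBm, hp, hq, le_antisymm ?_ (kemperman hAm hBm hp hq hsum.le), hsum⟩
  rw [← hpq, cosetMeasure_apply,
    ← haarProb_preimage_conjHom N p {n : N | (n : G) * (p * q) ∈ A * B}]
  exact measure_mono (leftSlice_mul_rightSlice_subset N A B p q)

end NormalSubgroup

/-! ### The sign of the conjugation action on a character -/

section Sign

variable {G : Type*} [Group G] [TopologicalSpace G] [IsTopologicalGroup G]
  (N : Subgroup G) [N.Normal]

theorem Circle.zpow_units_injective {z : Circle} (hz : z⁻¹ ≠ z) {u v : ℤˣ}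
    (h : z ^ (u : ℤ) = z ^ (v : ℤ)) : u = v := by
  rcases Int.units_eq_one_or u with rfl | rfl <;> rcases Int.units_eq_one_or v with rfl | rfl
  · rfl
  · exact absurd (by simpa using h.symm) hz
  · exact absurd (by simpa using h) hz
  · rfl

/-- A character which conjugation preserves up to inversion determines a sign homomorphism. -/
theorem exists_sign_hom {ξ : N →ₜ* Circle} (hξ : Function.Surjective ξ)
    (h : ∀ g : G, (∀ n, ξ (conjAut N g n) = ξ n) ∨ ∀ n, ξ (conjAut N g n) = (ξ n)⁻¹) :
    ∃ ε : (G ⧸ N) →ₜ* ℤˣ, ∀ (n : N) (p : G),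
      ξ (conjAut N p n) = ξ n ^ ((ε (p : G ⧸ N) : ℤˣ) : ℤ) := by
  have hex : ∀ g : G, ∃ u : ℤˣ, ∀ n, ξ (conjAut N g n) = ξ n ^ (u : ℤ) := fun g => by
    rcases h g with h | h
    · exact ⟨1, fun n => by simp [h]⟩
    · exact ⟨-1, fun n => by simp [h]⟩
  choose s hs using hex
  -- Since `ξ n₀` is not its own inverse, the sign can be read off at this one element.
  obtain ⟨n₀, hn₀⟩ := hξ (Circle.exp 1)
  have hne : (ξ n₀)⁻¹ ≠ ξ n₀ := by
    rw [hn₀, ← Circle.exp_neg]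
    intro h
    have := Circle.exp_injOn_Ioc (a := -Real.pi) (b := Real.pi) (by linarith)
      ⟨by linarith [Real.pi_gt_three], by linarith [Real.pi_gt_three]⟩
      ⟨by linarith [Real.pi_gt_three], by linarith [Real.pi_gt_three]⟩ h
    norm_num at this
  have huniq : ∀ g : G, ∀ u : ℤˣ, ξ (conjAut N g n₀) = ξ n₀ ^ (u : ℤ) → s g = u :=
    fun g u hu => Circle.zpow_units_injective hne ((hs g n₀).symm.trans hu)
  let S : G →* ℤˣ := MonoidHom.mk' s fun g k => huniq _ _ (by
    rw [conjAut_mul, hs, hs, ← zpow_mul, Units.val_mul, mul_comm])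
  -- Conjugation by an element of `N` is inner, hence invisible to a character with commutative
  -- target.
  have hker : N ≤ S.ker := fun m hm => huniq m 1 (by
    have : conjAut N m n₀ = ⟨m, hm⟩ * n₀ * ⟨m, hm⟩⁻¹ := Subtype.ext rfl
    rw [this, map_mul, map_mul, map_inv, mul_comm, inv_mul_cancel_left]
    simp)
  have hcont : Continuous S := by
    have hc : Continuous fun g : G => ξ (conjAut N g n₀) := by
      refine ξ.continuous_toFun.comp
        (Continuous.subtype_mk (f := fun g : G => g * (n₀ : G) * g⁻¹) (by fun_prop) _)
    have hcl : ∀ u : ℤˣ, IsClosed (S ⁻¹' {u}) := fun u => by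
      have : S ⁻¹' {u} = {g | ξ (conjAut N g n₀) = ξ n₀ ^ (u : ℤ)} := by
        ext g
        constructor
        · intro hg
          change s g = u at hg
          change _ = _
          rw [hs, hg]
        · exact huniq g u
      rw [this]
      exact isClosed_eq hc continuous_const
    refine continuous_discrete_rng.2 fun u => ?_
    have : S ⁻¹' {u} = (S ⁻¹' {-u})ᶜ := by
      ext g
      rcases Int.units_eq_one_or u with rfl | rfl <;>
        rcases Int.units_eq_one_or (S g) with hg | hg <;> simp [hg]
    rw [this]
    exact (hcl _).isOpen_compl
  exact ⟨⟨QuotientGroup.lift N S hker, hcont.quotient_lift _⟩, fun n p => hs p n⟩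

end Sign

/-! ### Linking generic pairs of cosets -/

section CriticalAt

open Real

set_option linter.unusedSectionVars false

variable {G : Type*} [Group G] [TopologicalSpace G] [IsTopologicalGroup G]
  [T2Space G] [CompactSpace G] [SecondCountableTopology G] [MeasurableSpace G] [BorelSpace G]
  (N : Subgroup G) [N.Normal] [CompactSpace N]

/-- The cosets of `p` and `q` are generic for the pair `(A, B)`. -/
structure IsCriticalAt (A B : Set G) (p q : G) : Prop where
  left : cosetMeasure N p A = haarProb G A
  right : cosetMeasure N q B = haarProb G B
  mul : cosetMeasure N (p * q) (A * B) = haarProb G A + haarProb G B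

variable {N} {A B : Set G} {p q : G}

theorem IsCriticalAt.haarProb_leftSlice (h : IsCriticalAt N A B p q) :
    haarProb N (leftSlice N A p) = haarProb G A := by
  rw [_root_.haarProb_leftSlice, h.left]

theorem IsCriticalAt.haarProb_rightSlice (h : IsCriticalAt N A B p q) :
    haarProb N (rightSlice N B q) = haarProb G B := by
  rw [_root_.haarProb_rightSlice, h.right]

theorem IsCriticalAt.isCriticalPair [PreconnectedSpace N] (h : IsCriticalAt N A B p q)
    (hA : MeasurableSet A) (hB : MeasurableSet B) (hA0 : 0 < haarProb G A)
    (hB0 : 0 < haarProb G B) (hlt : haarProb G A + haarProb G B < 1) :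
    IsCriticalPair (leftSlice N A p) (rightSlice N B q) :=
  isCriticalPair_slices N hA hB (by rwa [h.left]) (by rwa [h.right])
    (by rwa [h.left, h.right]) (by rw [h.left, h.right, h.mul])

theorem IsCriticalAt.exists_character (hN : IsKneserGroup N) (h : IsCriticalAt N A B p q)
    (hA : MeasurableSet A) (hB : MeasurableSet B) (hA0 : 0 < haarProb G A)
    (hB0 : 0 < haarProb G B) (hlt : haarProb G A + haarProb G B < 1) :
    ∃ ξ : N →ₜ* Circle, Function.Surjective ξ ∧ ∃ a b : Circle,
      leftSlice N A p ⊆ ξ ⁻¹' (symmArc (π * (haarProb G).real A) * {a}) ∧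
      rightSlice N B q ⊆ ξ ⁻¹' (symmArc (π * (haarProb G).real B) * {b}) := by
  have := hN.1
  have h1 := hN.exists_character (h.isCriticalPair hA hB hA0 hB0 hlt)
  rwa [measureReal_def, measureReal_def, h.haarProb_leftSlice, h.haarProb_rightSlice] at h1

theorem pi_mul_measureReal_pos (hA0 : 0 < haarProb G A) : 0 < π * (haarProb G).real A :=
  mul_pos pi_pos (ENNReal.toReal_pos hA0.ne' (by finiteness))

theorem pi_mul_measureReal_add_lt (hlt : haarProb G A + haarProb G B < 1) :
    π * (haarProb G).real A + π * (haarProb G).real B < π := by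
  have h := (ENNReal.toReal_lt_toReal (by finiteness) (by finiteness)).2 hlt
  rw [ENNReal.toReal_add (by finiteness) (by finiteness), ENNReal.toReal_one] at h
  rw [← mul_add]
  exact mul_lt_of_lt_one_right pi_pos h

theorem ofReal_pi_mul_measureReal_div : ENNReal.ofReal (π * (haarProb G).real A / π) =
    haarProb G A := by
  rw [mul_div_cancel_left₀ _ pi_ne_zero, ofReal_measureReal]

/-- The character obtained on one pair of cosets works for all pairs of cosets linked to it. -/
theorem IsCriticalAt.exists_subset_preimage (hN : IsKneserGroup N) (hA : MeasurableSet A)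
    (hB : MeasurableSet B) (hA0 : 0 < haarProb G A) (hB0 : 0 < haarProb G B)
    (hlt : haarProb G A + haarProb G B < 1) {p₀ : G} {ξ : N →ₜ* Circle}
    (hξ : Function.Surjective ξ) {a₀ : Circle}
    (hsub : leftSlice N A p₀ ⊆ ξ ⁻¹' (symmArc (π * (haarProb G).real A) * {a₀}))
    (h₀ : IsCriticalAt N A B p₀ q) (h : IsCriticalAt N A B p q) :
    (∃ a, leftSlice N A p ⊆ ξ ⁻¹' (symmArc (π * (haarProb G).real A) * {a})) ∧
    ∃ b, rightSlice N B q ⊆ ξ ⁻¹' (symmArc (π * (haarProb G).real B) * {b}) := by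
  have hrA := pi_mul_measureReal_pos hA0
  have hrB := pi_mul_measureReal_pos hB0
  have hr := pi_mul_measureReal_add_lt hlt
  obtain ⟨η, hη, a, b, ha, hb⟩ := h₀.exists_character hN hA hB hA0 hB0 hlt
  -- The common slice of `A` at `p₀` relates `η` to `ξ`; below, the common slice of `B` at `q`
  -- relates `ζ` to `ξ`.
  have e1 := eq_or_eq_inv_of_subset_preimage hξ hη hrA (by linarith)
    (measurableSet_leftSlice N hA p₀)
    (by rw [h₀.haarProb_leftSlice, ofReal_pi_mul_measureReal_div]) hsub ha
  obtain ⟨c, hc⟩ := exists_subset_preimage_of_eq_or_eq_inv e1 hb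
  obtain ⟨ζ, hζ, a', b', ha', hb'⟩ := h.exists_character hN hA hB hA0 hB0 hlt
  have e2 := eq_or_eq_inv_of_subset_preimage hξ hζ hrB (by linarith)
    (measurableSet_rightSlice N hB q)
    (by rw [h.haarProb_rightSlice, ofReal_pi_mul_measureReal_div]) hc hb'
  exact ⟨exists_subset_preimage_of_eq_or_eq_inv e2 ha', c, hc⟩

theorem surjective_comp_conjHom {ξ : N →ₜ* Circle} (hξ : Function.Surjective ξ) (p : G) :
    Function.Surjective (ξ.comp (conjHom N p)) := fun z => by
  obtain ⟨n, rfl⟩ := hξ z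
  obtain ⟨m, rfl⟩ := conjHom_surjective N p n
  exact ⟨m, rfl⟩

/-- The conjugated product of slices lies in both sets and has full outer measure in each. The
right-hand side depends only on `p * q`, which allows different factorizations to be compared. -/
theorem IsCriticalAt.preimage_ae_eq [PreconnectedSpace N] (hA : MeasurableSet A)
    (hB : MeasurableSet B) (hA0 : 0 < haarProb G A) (hB0 : 0 < haarProb G B)
    (hlt : haarProb G A + haarProb G B < 1) {ξ : N →ₜ* Circle}
    (hξ : Function.Surjective ξ) {a b : Circle} (h : IsCriticalAt N A B p q)
    (ha : leftSlice N A p ⊆ ξ ⁻¹' (symmArc (π * (haarProb G).real A) * {a}))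
    (hb : rightSlice N B q ⊆ ξ ⁻¹' (symmArc (π * (haarProb G).real B) * {b})) :
    (ξ.comp (conjHom N p⁻¹)) ⁻¹'
      (symmArc (π * (haarProb G).real A + π * (haarProb G).real B) * {a * b}) =ᵐ[haarProb N]
      toMeasurable (haarProb N) {n : N | (n : G) * (p * q) ∈ A * B} := by
  have hrA := pi_mul_measureReal_pos hA0
  have hrB := pi_mul_measureReal_pos hB0
  have hr := pi_mul_measureReal_add_lt hlt
  have hcrit := h.isCriticalPair hA hB hA0 hB0 hlt
  have hinv : ∀ n, conjHom N p (conjHom N p⁻¹ n) = n := fun n => by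
    have := conjAut_inv_apply_self N p⁻¹ n
    rwa [inv_inv] at this
  have hC : haarProb N (conjHom N p⁻¹ ⁻¹' (leftSlice N A p * rightSlice N B q)) =
      haarProb G A + haarProb G B := by
    rw [haarProb_preimage_conjHom, hcrit.measure_mul, h.haarProb_leftSlice,
      h.haarProb_rightSlice]
  refine ae_eq_toMeasurable_of_subset
    (C := conjHom N p⁻¹ ⁻¹' (leftSlice N A p * rightSlice N B q))
    (measurableSet_preimage_symmArc _ _ _) ?_ ?_ ?_ ?_
  · intro n hn
    obtain ⟨x, hx, y, hy, hxy⟩ := hn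
    have h1 := Set.mul_mem_mul (Set.mem_preimage.1 (ha hx)) (Set.mem_preimage.1 (hb hy))
    rw [mul_mul_mul_comm, symmArc_mul_symmArc hrA.le hrB.le, Set.singleton_mul_singleton,
      ← map_mul] at h1
    have h2 : ξ (conjHom N p⁻¹ n) ∈ symmArc (π * (haarProb G).real A + π * (haarProb G).real B) *
        {a * b} := by
      rw [← hxy]
      exact h1
    exact h2
  · intro n hn
    have := leftSlice_mul_rightSlice_subset N A B p q hn
    rwa [Set.mem_preimage, hinv] at this
  · rw [hC, haarProb_preimage_symmArc _ (surjective_comp_conjHom hξ p⁻¹),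
      haarProb_symmArc hr, add_div, ENNReal.ofReal_add (by positivity) (by positivity),
      ofReal_pi_mul_measureReal_div, ofReal_pi_mul_measureReal_div]
  · rw [hC, ← cosetMeasure_apply, h.mul]

/-- Two elements of a compact group whose difference is prescribed, with generic partners having
the same product. -/
theorem exists_mul_eq_mul_of_ae {Y : Set (G × G)}
    (hY : ((haarProb G).prod (haarProb G)) Yᶜ = 0) (g : G) :
    ∃ p q p' q' : G, (p, q) ∈ Y ∧ (p', q') ∈ Y ∧ p * q = p' * q' ∧ p' = p * g := by
  have h1 : ∀ᵐ p ∂(haarProb G), ∀ᵐ q ∂(haarProb G), (p, q) ∈ Y :=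
    Measure.ae_ae_of_ae_prod (mem_ae_iff.2 hY)
  have h2 := (eventually_mul_right_iff (haarProb G) g).2 h1
  obtain ⟨p, hp, hp'⟩ := (h1.and h2).exists
  -- Invariance of the measure makes both `q` and `(pg)⁻¹pq` generic partners, of `p` and `pg`
  -- respectively.
  have h3 := (eventually_mul_left_iff (haarProb G) ((p * g)⁻¹ * p)).2 hp'
  obtain ⟨q, hq, hq'⟩ := (hp.and h3).exists
  exact ⟨p, q, p * g, (p * g)⁻¹ * p * q, hq, hq', by group, rfl⟩

end CriticalAt

/-! ### Gluing over a conull set of pairs -/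

theorem proposition1 {G : Type*} [Group G] [TopologicalSpace G] [IsTopologicalGroup G]
    [T2Space G] [CompactSpace G] [SecondCountableTopology G] [MeasurableSpace G] [BorelSpace G]
    (hsplit : Splits (identityComponent G))
    (hKneser : IsKneserGroup (identityComponent G))
    (A B : Set G) (hAB : IsCriticalPairRel (identityComponent G) A B) :
    ∃ (ξ : identityComponent G →ₜ* Circle) (I₀ J₀ : Set Circle),
      Function.Surjective ξ ∧
      IsClosedSymmetricInterval I₀ ∧ IsClosedSymmetricInterval J₀ ∧
      haarProb G A = haarProb Circle I₀ ∧ haarProb G B = haarProb Circle J₀ ∧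
      ∃ (X : Set G) (Y : Set (G × G)) (α₀ β₀ : X → Circle),
        MeasurableSet X ∧ haarProb G Xᶜ = 0 ∧
        MeasurableSet Y ∧ Y ⊆ X ×ˢ X ∧ ((haarProb G).prod (haarProb G)) Yᶜ = 0 ∧
        Measurable α₀ ∧ Measurable β₀ ∧
        (∀ p q : X, ((p : G), (q : G)) ∈ Y →
          leftSlice (identityComponent G) A p ⊆ ξ ⁻¹' (I₀ * {α₀ p}) ∧
          rightSlice (identityComponent G) B q ⊆ ξ ⁻¹' (J₀ * {β₀ q})) ∧
        ∃ ε : (G ⧸ identityComponent G) →ₜ* ℤˣ,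
          (∀ (n : identityComponent G) (p : G),
            ξ (conjAut (identityComponent G) p n) =
              ξ n ^ ((ε (p : G ⧸ identityComponent G) : ℤˣ) : ℤ)) ∧
          ∀ p q p' q' : X, ((p : G), (q : G)) ∈ Y → ((p' : G), (q' : G)) ∈ Y →
            (p : G) * (q : G) = (p' : G) * (q' : G) →
            (α₀ p * β₀ q) ^ ((ε ((p : G) : G ⧸ identityComponent G) : ℤˣ) : ℤ) =
              (α₀ p' * β₀ q') ^ ((ε ((p' : G) : G ⧸ identityComponent G) : ℤˣ) : ℤ) := by
  have hconn := hKneser.1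
  obtain ⟨hA, hB, hA0, hB0, hlt, X, Z, hX, hX0, hZ, hZX, hZ0, hXm, hZm⟩ := hAB
  set N := identityComponent G
  set r := Real.pi * (haarProb G).real A
  set s := Real.pi * (haarProb G).real B
  have hr : 0 < r := pi_mul_measureReal_pos hA0
  have hs : 0 < s := pi_mul_measureReal_pos hB0
  have hrs : r + s < Real.pi := pi_mul_measureReal_add_lt hlt
  have hmr : ENNReal.ofReal (r / Real.pi) = haarProb G A := ofReal_pi_mul_measureReal_div
  have hms : ENNReal.ofReal (s / Real.pi) = haarProb G B := ofReal_pi_mul_measureReal_div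
  have hcrit : ∀ p q, (p, q) ∈ Z → IsCriticalAt N A B p q := fun p q h => by
    have hp := (hXm p (hZX h).1).1
    have hq := (hXm q (hZX h).2).2
    exact ⟨hp, hq, by rw [hZm p q h, hp, hq]⟩
  obtain ⟨p₀, hp₀⟩ : ∃ p₀, ∀ᵐ q ∂(haarProb G), (p₀, q) ∈ Z :=
    (Measure.ae_ae_of_ae_prod (mem_ae_iff.2 hZ0)).exists
  obtain ⟨q₀, hq₀⟩ := hp₀.exists
  obtain ⟨ξ, hξ, a₀, -, ha₀, -⟩ :=
    (hcrit p₀ q₀ hq₀).exists_character hKneser hA hB hA0 hB0 hlt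
  -- Requiring also `(p₀, q) ∈ Z` links every pair of `Y` to the coset where `ξ` was chosen.
  let Y : Set (G × G) := Z ∩ {x | (p₀, x.2) ∈ Z}
  have hYZ : Y ⊆ Z := Set.inter_subset_left
  have hYm : MeasurableSet Y :=
    hZ.inter ((measurable_const.prodMk measurable_snd : Measurable fun x : G × G => (p₀, x.2)) hZ)
  have hY0 : ((haarProb G).prod (haarProb G)) Yᶜ = 0 := by
    rw [← mem_ae_iff]
    have h1 : ∀ᵐ x ∂((haarProb G).prod (haarProb G)), x ∈ Z := mem_ae_iff.2 hZ0
    exact h1.and (Measure.quasiMeasurePreserving_snd.ae hp₀)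
  let α : G → Circle := fun p => characterPhase ξ (leftSlice N A p)
  let β : G → Circle := fun q => characterPhase ξ (rightSlice N B q)
  have hY : ∀ p q, (p, q) ∈ Y → leftSlice N A p ⊆ ξ ⁻¹' (symmArc r * {α p}) ∧
      rightSlice N B q ⊆ ξ ⁻¹' (symmArc s * {β q}) := by
    intro p q h
    have hc := hcrit p q h.1
    obtain ⟨⟨a, ha⟩, b, hb⟩ := (hcrit p₀ q h.2).exists_subset_preimage hKneser hA hB hA0 hB0 hlt
      hξ ha₀ hc
    have e1 : α p = a := characterPhase_eq hξ hr (by linarith) (measurableSet_leftSlice N hA p)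
      (by rw [hc.haarProb_leftSlice, hmr]) ha
    have e2 : β q = b := characterPhase_eq hξ hs (by linarith) (measurableSet_rightSlice N hB q)
      (by rw [hc.haarProb_rightSlice, hms]) hb
    rw [e1, e2]
    exact ⟨ha, hb⟩
  have hae : ∀ p q p' q', (p, q) ∈ Y → (p', q') ∈ Y → p * q = p' * q' →
      (ξ.comp (conjHom N p⁻¹)) ⁻¹' (symmArc (r + s) * {α p * β q}) =ᵐ[haarProb N]
      (ξ.comp (conjHom N p'⁻¹)) ⁻¹' (symmArc (r + s) * {α p' * β q'}) := by
    intro p q p' q' h h' e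
    have h1 := (hcrit p q h.1).preimage_ae_eq hA hB hA0 hB0 hlt hξ (hY p q h).1 (hY p q h).2
    have h2 := (hcrit p' q' h'.1).preimage_ae_eq hA hB hA0 hB0 hlt hξ (hY p' q' h').1
      (hY p' q' h').2
    rw [← e] at h2
    exact h1.trans h2.symm
  have hconj : ∀ g : G, (∀ n, ξ (conjAut N g n) = ξ n) ∨ ∀ n, ξ (conjAut N g n) = (ξ n)⁻¹ := by
    intro g
    obtain ⟨p, q, p', q', h, h', e, rfl⟩ := exists_mul_eq_mul_of_ae hY0 g
    -- Evaluating at the conjugate of `n` by `pg` turns the two conjugated characters into `ξ` at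
    -- the conjugate of `n` by `g` and `ξ n`.
    have key : ∀ n, ξ.comp (conjHom N p⁻¹) (conjAut N (p * g) n) = ξ (conjAut N g n) ∧
        ξ.comp (conjHom N (p * g)⁻¹) (conjAut N (p * g) n) = ξ n := fun n => by
      refine ⟨congrArg ξ ?_, congrArg ξ (conjAut_inv_apply_self N (p * g) n)⟩
      rw [conjAut_mul]
      exact conjAut_inv_apply_self N p _
    rcases eq_or_eq_inv_of_preimage_symmArc_ae_eq _ _ (surjective_comp_conjHom hξ _)
      (surjective_comp_conjHom hξ _) (by linarith) hrs (hae p q (p * g) q' h h' e) with h1 | h1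
    · exact Or.inl fun n => by rw [← (key n).1, h1, (key n).2]
    · exact Or.inr fun n => by rw [← (key n).1, h1, (key n).2]
  obtain ⟨ε, hε⟩ := exists_sign_hom N hξ hconj
  refine ⟨ξ, symmArc r, symmArc s, hξ, ⟨r, hr.le, rfl⟩, ⟨s, hs.le, rfl⟩,
    by rw [haarProb_symmArc (by linarith), hmr], by rw [haarProb_symmArc (by linarith), hms],
    X, Y, fun p => α p, fun q => β q, hX, hX0, hYm, hYZ.trans hZX, hY0,
    (measurable_characterPhase_leftSlice N ξ hA).comp measurable_subtype_coe,
    (measurable_characterPhase_rightSlice N ξ hB).comp measurable_subtype_coe,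
    fun p q h => hY p q h, ε, hε, ?_⟩
  intro p q p' q' h h' e
  -- Conjugation by `g⁻¹` has the same sign as `g`, and a symmetric arc is stable under inversion,
  -- so only the centre changes.
  have hpre : ∀ (g : G) (c : Circle),
      (ξ.comp (conjHom N g⁻¹)) ⁻¹' (symmArc (r + s) * {c}) =
        ξ ⁻¹' (symmArc (r + s) * {c ^ ((ε (g : G ⧸ N) : ℤˣ) : ℤ)}) := by
    intro g c
    ext n
    have h1 : ξ.comp (conjHom N g⁻¹) n = ξ n ^ ((ε (g : G ⧸ N) : ℤˣ) : ℤ) := by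
      have h2 := hε n g⁻¹
      rw [QuotientGroup.mk_inv, map_inv, Int.units_inv_eq_self] at h2
      exact h2
    rw [Set.mem_preimage, h1, Set.mem_preimage]
    rcases Int.units_eq_one_or (ε (g : G ⧸ N)) with hu | hu
    · simp [hu]
    · rw [hu]
      simp only [Units.val_neg, Units.val_one, zpow_neg, zpow_one]
      exact inv_mem_symmArc_mul_singleton
  have h3 := hae p q p' q' h h' e
  rw [hpre, hpre] at h3
  exact eq_of_preimage_symmArc_ae_eq ξ hξ (by linarith) hrs h3
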